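/- Let $G$ be a (finite-dimensional real) Lie group and let $M$ be a (finite-dimensional real) smooth manifold, both Hausdorff with countable basis. Let $d$ be a metric on $M$ that induces the manifold topology, let $X\subset M$ be compact, and let $G\times M\to M$, $(g,x)\mapsto gx$, be a smooth left action by isometries of $(M,d)$, i.e. $d(gx,gy)=d(x,y)$ for all $g\in G$, $x,y\in M$. Let $H_X=\{g\in G: gX=X\}$ and endow $G/H_X$ with the metric $d_X(gH_X,hH_X)=d_H(gX,hX)$, where $d_H$ is the Hausdorff distance of $(M,d)$ (with $d_H(\emptyset,\emptyset)=0$). Let $\tau$ be the quotient topology of $G/H_X$. Then there exists $\varepsilon>0$ such that, for every $c\in G/H_X$, the open ball $B_{d_X}(c,\varepsilon)=\{p\in G/H_X: d_X(p,c)<\varepsilon\}$ is contained in a countable (finite or infinite) union of pairwise disjoint $\tau$-compact subsets of $G/H_X$. -/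

import Mathlib

open scoped Manifold ContDiff Pointwise

/-- The isotropy subgroup `H_X = {g ∈ G : g X = X}` of a subset `X ⊆ M`. -/
abbrev isotropySubgroup (G : Type*) {M : Type*} [Group G] [MulAction G M] (X : Set M) :
    Subgroup G :=
  MulAction.stabilizer G X

theorem mem_isotropySubgroup_iff {G M : Type*} [Group G] [MulAction G M] (X : Set M) (g : G) :
    g ∈ isotropySubgroup G X ↔ (fun x : M => g • x) '' X = X :=
  Iff.rfl

/-- The induced Hausdorff metric `d_X (g H_X, h H_X) = d_H (g X, h X)` on `G ⧸ H_X`, where `d_H` is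
the Hausdorff distance of `M`. Here `MulAction.ofQuotientStabilizer G X` is the well-defined map
`g H_X ↦ g X`. -/
noncomputable def inducedHausdorffDist {G M : Type*} [Group G] [MetricSpace M] [MulAction G M]
    (X : Set M) (p q : G ⧸ isotropySubgroup G X) : ℝ :=
  Metric.hausdorffDist (MulAction.ofQuotientStabilizer G X p) (MulAction.ofQuotientStabilizer G X q)

theorem inducedHausdorffDist_mk {G M : Type*} [Group G] [MetricSpace M] [MulAction G M]
    (X : Set M) (g h : G) :
    inducedHausdorffDist X (QuotientGroup.mk g : G ⧸ isotropySubgroup G X) (QuotientGroup.mk h) =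
      Metric.hausdorffDist (g • X) (h • X) :=
  rfl

/-- The open ball of `d_X` with centre `c` and radius `r` in `G ⧸ H_X`. -/
def inducedHausdorffBall {G M : Type*} [Group G] [MetricSpace M] [MulAction G M]
    (X : Set M) (c : G ⧸ isotropySubgroup G X) (r : ℝ) : Set (G ⧸ isotropySubgroup G X) :=
  {p | inducedHausdorffDist X p c < r}

section

variable {G M : Type*} [Group G] [MetricSpace M] [MulAction G M]

/-! The function `d_X` is `G`-invariant and `τ`-continuous, and `G ⧸ H_X` is locally compact and
Lindelöf. Let `V` be a compact neighbourhood of the base point `e`. On the compact set `V \ interior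
V`, `d_X(·, e)` is bounded below by some `δ > 0`. If `B` is a closed `δ/3`-ball and `g • e ∈ B`,
invariance shows that `B` misses `g • (V \ interior V)`, so `g • V ∩ B` is compact and relatively
open in `B`. Countably many such pieces cover `B` and can be made disjoint. -/

theorem inducedHausdorffDist_comm (X : Set M) (p q : G ⧸ isotropySubgroup G X) :
    inducedHausdorffDist X p q = inducedHausdorffDist X q p :=
  Metric.hausdorffDist_comm

/-- `Metric.hausdorffDist` takes the value 0 at infinite distance, so the triangle inequality and
separation of points rest on this finiteness. -/
theorem hausdorffEDist_smul_ne_top [TopologicalSpace G] [ContinuousSMul G M] {X : Set M}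
    (hX : IsCompact X) (hne : X.Nonempty) (g h : G) :
    Metric.hausdorffEDist (g • X) (h • X) ≠ ⊤ :=
  Metric.hausdorffEDist_ne_top_of_nonempty_of_bounded hne.smul_set hne.smul_set
    (hX.smul g).isBounded (hX.smul h).isBounded

theorem inducedHausdorffDist_triangle [TopologicalSpace G] [ContinuousSMul G M] {X : Set M}
    (hX : IsCompact X) (hne : X.Nonempty) (p q r : G ⧸ isotropySubgroup G X) :
    inducedHausdorffDist X p r ≤ inducedHausdorffDist X p q + inducedHausdorffDist X q r := by
  induction p using QuotientGroup.induction_on with | _ a => ?_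
  induction q using QuotientGroup.induction_on with | _ b => ?_
  exact Metric.hausdorffDist_triangle (hausdorffEDist_smul_ne_top hX hne a b)

theorem eq_of_inducedHausdorffDist_eq_zero [TopologicalSpace G] [ContinuousSMul G M] {X : Set M}
    (hX : IsCompact X) (hne : X.Nonempty) {p q : G ⧸ isotropySubgroup G X}
    (h : inducedHausdorffDist X p q = 0) : p = q := by
  induction p using QuotientGroup.induction_on with | _ a => ?_
  induction q using QuotientGroup.induction_on with | _ b => ?_
  exact MulAction.injective_ofQuotientStabilizer G X
    (((hX.smul a).isClosed.hausdorffDist_zero_iff_eq (hX.smul b).isClosed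
      (hausdorffEDist_smul_ne_top hX hne a b)).1 h)

theorem inducedHausdorffDist_smul [IsIsometricSMul G M] (X : Set M) (g : G)
    (p q : G ⧸ isotropySubgroup G X) :
    inducedHausdorffDist X (g • p) (g • q) = inducedHausdorffDist X p q := by
  simp only [inducedHausdorffDist, MulAction.ofQuotientStabilizer_smul]
  exact Metric.hausdorffDist_image (isometry_smul M g)

/-- The translates of a compact set depend continuously on the group element. -/
theorem eventually_hausdorffDist_smul_lt [TopologicalSpace G] [ContinuousSMul G M] {X : Set M}
    (hX : IsCompact X) (g₀ : G) {ε : ℝ} (hε : 0 < ε) :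
    ∀ᶠ g in nhds g₀, Metric.hausdorffDist (g • X) (g₀ • X) < ε := by
  have hnear : ∀ᶠ g in nhds g₀, ∀ x ∈ X, dist (g • x) (g₀ • x) < ε / 2 := by
    refine hX.eventually_forall_of_forall_eventually fun x _ => ?_
    have hc : Continuous fun z : G × M => dist (z.1 • z.2) (g₀ • z.2) := by fun_prop
    exact hc.continuousAt.eventually_lt continuousAt_const (by simpa using half_pos hε)
  filter_upwards [hnear] with g hg
  refine (Metric.hausdorffDist_le_of_mem_dist (half_pos hε).le ?_ ?_).trans_lt (half_lt_self hε)
  · rintro _ ⟨x, hx, rfl⟩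
    exact ⟨g₀ • x, Set.smul_mem_smul_set hx, (hg x hx).le⟩
  · rintro _ ⟨x, hx, rfl⟩
    exact ⟨g • x, Set.smul_mem_smul_set hx, by simpa [dist_comm] using (hg x hx).le⟩

theorem continuous_inducedHausdorffDist [TopologicalSpace G] [ContinuousSMul G M] {X : Set M}
    (hX : IsCompact X) (hne : X.Nonempty) (c : G ⧸ isotropySubgroup G X) :
    Continuous fun p => inducedHausdorffDist X p c := by
  refine (QuotientGroup.isQuotientMap_mk (N := isotropySubgroup G X)).continuous_iff.2
    (continuous_iff_continuousAt.2 fun g₀ => Metric.tendsto_nhds.2 fun ε hε => ?_)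
  filter_upwards [eventually_hausdorffDist_smul_lt hX g₀ hε] with g hg
  rw [← inducedHausdorffDist_mk] at hg
  have h₁ := inducedHausdorffDist_triangle hX hne (QuotientGroup.mk g) (QuotientGroup.mk g₀) c
  have h₂ := inducedHausdorffDist_triangle hX hne (QuotientGroup.mk g₀) (QuotientGroup.mk g) c
  rw [inducedHausdorffDist_comm X (QuotientGroup.mk g₀) (QuotientGroup.mk g)] at h₂
  rw [Real.dist_eq, abs_lt]
  constructor <;> simp only [Function.comp_apply] <;> linarith

end

/-- A Lindelöf set in which every point has a compact relatively open neighbourhood is a countable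
disjoint union of compact sets. -/
theorem IsLindelof.exists_countable_pairwiseDisjoint_isCompact {Y : Type*} [TopologicalSpace Y]
    {B : Set Y} (hB : IsLindelof B)
    (h : ∀ p ∈ B, ∃ U : Set Y, IsOpen U ∧ p ∈ U ∧ IsCompact (U ∩ B)) :
    ∃ 𝒦 : Set (Set Y), 𝒦.Countable ∧ (∀ K ∈ 𝒦, IsCompact K) ∧ 𝒦.PairwiseDisjoint id ∧
      B ⊆ ⋃₀ 𝒦 := by
  rcases B.eq_empty_or_nonempty with rfl | hne
  · exact ⟨∅, by simp⟩
  choose! U hUo hpU hUc using h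
  obtain ⟨t, ht, htB, hcov⟩ := hB.elim_nhds_subcover U fun p hp => (hUo p hp).mem_nhds (hpU p hp)
  have htne : t.Nonempty := by
    obtain ⟨p, hp⟩ := hne
    obtain ⟨x, hx, -⟩ := Set.mem_iUnion₂.1 (hcov hp)
    exact ⟨x, hx⟩
  obtain ⟨f, rfl⟩ := ht.exists_eq_range htne
  have hfB : ∀ n, f n ∈ B := fun n => htB _ ⟨n, rfl⟩
  refine ⟨Set.range fun n => disjointed (U ∘ f) n ∩ B, Set.countable_range _, ?_, ?_, ?_⟩
  · rintro _ ⟨n, rfl⟩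
    -- Removing the earlier open sets amounts to intersecting with a closed set, so compactness
    -- survives.
    have hclosed : IsClosed (⋂ i < n, ((U ∘ f) i)ᶜ) :=
      isClosed_biInter fun i _ => (hUo _ (hfB i)).isClosed_compl
    dsimp only
    rw [disjointed_eq_inter_compl, Set.inter_right_comm]
    exact (hUc _ (hfB n)).inter_right hclosed
  · refine Pairwise.range_pairwise fun i j hij => ?_
    exact (disjoint_disjointed (U ∘ f) hij).mono Set.inter_subset_left Set.inter_subset_left
  · intro p hp
    have hpU' : p ∈ ⋃ n, disjointed (U ∘ f) n := by
      rw [iUnion_disjointed]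
      simpa using hcov hp
    obtain ⟨n, hn⟩ := Set.mem_iUnion.1 hpU'
    exact ⟨_, ⟨n, rfl⟩, hn, hp⟩

/-- Around the base point of `G ⧸ H_X`, small closed balls of the induced Hausdorff metric do not
meet the boundary of a suitable compact neighbourhood. -/
theorem exists_isCompact_forall_inducedHausdorffDist_lt_mem_interior {G M : Type*} [Group G]
    [TopologicalSpace G] [IsTopologicalGroup G] [LocallyCompactSpace G] [MetricSpace M]
    [MulAction G M] [ContinuousSMul G M] {X : Set M} (hX : IsCompact X) (hne : X.Nonempty)
    (e : G ⧸ isotropySubgroup G X) :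
    ∃ V : Set (G ⧸ isotropySubgroup G X), IsCompact V ∧ e ∈ interior V ∧
      ∃ δ : ℝ, 0 < δ ∧ ∀ q ∈ V, inducedHausdorffDist X q e < δ → q ∈ interior V := by
  obtain ⟨V, hVc, hVe⟩ := exists_compact_mem_nhds e
  have heV : e ∈ interior V := mem_interior_iff_mem_nhds.2 hVe
  refine ⟨V, hVc, heV, ?_⟩
  have hnonneg : ∀ q, 0 ≤ inducedHausdorffDist X q e := fun _ => Metric.hausdorffDist_nonneg
  -- This also yields a positive `δ` when `V \ interior V` is empty.
  obtain ⟨δ, hδ, hle⟩ := (hVc.diff isOpen_interior).exists_forall_le'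
    (continuous_inducedHausdorffDist hX hne e).continuousOn (a := 0) fun q hq =>
      (hnonneg q).lt_of_ne fun h0 => hq.2 <| by
        rwa [eq_of_inducedHausdorffDist_eq_zero hX hne h0.symm]
  exact ⟨δ, hδ, fun q hq hlt => by_contra fun hqi => (hle q ⟨hq, hqi⟩).not_gt hlt⟩

theorem exists_inducedHausdorffBall_subset_sUnion_isCompact {G M : Type*} [Group G]
    [TopologicalSpace G] [IsTopologicalGroup G] [LocallyCompactSpace G] [LindelofSpace G]
    [MetricSpace M] [MulAction G M] [ContinuousSMul G M] [IsIsometricSMul G M] {X : Set M}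
    (hX : IsCompact X) (hne : X.Nonempty) :
    ∃ ε : ℝ, 0 < ε ∧ ∀ c : G ⧸ isotropySubgroup G X,
      ∃ 𝒦 : Set (Set (G ⧸ isotropySubgroup G X)),
        𝒦.Countable ∧ (∀ K ∈ 𝒦, IsCompact K) ∧ 𝒦.PairwiseDisjoint id ∧
          inducedHausdorffBall X c ε ⊆ ⋃₀ 𝒦 := by
  set e : G ⧸ isotropySubgroup G X := QuotientGroup.mk 1
  obtain ⟨V, hVc, heV, δ, hδ, hV⟩ :=
    exists_isCompact_forall_inducedHausdorffDist_lt_mem_interior hX hne e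
  -- Two points of a closed `δ/3`-ball are at distance at most `2δ/3 < δ`.
  refine ⟨δ / 3, by positivity, fun c => ?_⟩
  set B : Set (G ⧸ isotropySubgroup G X) := {p | inducedHausdorffDist X p c ≤ δ / 3}
  have hBclosed : IsClosed B :=
    isClosed_le (continuous_inducedHausdorffDist hX hne c) continuous_const
  have : LindelofSpace (G ⧸ isotropySubgroup G X) := by
    rw [← isLindelof_univ_iff, ← (QuotientGroup.mk_surjective (s := isotropySubgroup G X)).range_eq]
    exact isLindelof_range QuotientGroup.continuous_mk
  have hB : IsLindelof B := hBclosed.isLindelof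
  obtain ⟨𝒦, h𝒦, hc, hd, hcov⟩ := hB.exists_countable_pairwiseDisjoint_isCompact fun p hp => by
    obtain ⟨g, rfl⟩ := QuotientGroup.mk_surjective p
    have hge : (QuotientGroup.mk g : G ⧸ isotropySubgroup G X) = g • e :=
      congrArg QuotientGroup.mk (mul_one g).symm
    refine ⟨g • interior V, isOpen_interior.smul g, hge ▸ Set.smul_mem_smul_set heV, ?_⟩
    have heq : g • interior V ∩ B = g • V ∩ B := by
      refine Set.Subset.antisymm
        (Set.inter_subset_inter_left _ (Set.smul_set_mono interior_subset)) ?_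
      rintro _ ⟨⟨q, hq, rfl⟩, hqB⟩
      refine ⟨Set.smul_mem_smul_set (hV q hq ?_), hqB⟩
      have htri := inducedHausdorffDist_triangle hX hne (g • q) c (g • e)
      rw [inducedHausdorffDist_smul, inducedHausdorffDist_comm X c, ← hge] at htri
      have h₁ : inducedHausdorffDist X (g • q) c ≤ δ / 3 := hqB
      have h₂ : inducedHausdorffDist X (QuotientGroup.mk g) c ≤ δ / 3 := hp
      linarith
    rw [heq]
    exact (hVc.smul g).inter_right hBclosed
  exact ⟨𝒦, h𝒦, hc, hd, fun p (hp : inducedHausdorffDist X p c < δ / 3) => hcov hp.le⟩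

theorem mainTheorem6 {n m : ℕ}
    {G : Type*} [Group G] [TopologicalSpace G] [ChartedSpace (EuclideanSpace ℝ (Fin n)) G]
    [LieGroup (𝓡 n) ∞ G] [T2Space G] [SecondCountableTopology G]
    {M : Type*} [MetricSpace M] [ChartedSpace (EuclideanSpace ℝ (Fin m)) M]
    [IsManifold (𝓡 m) ∞ M] [SecondCountableTopology M]
    [MulAction G M]
    (hsmooth : ContMDiff ((𝓡 n).prod (𝓡 m)) (𝓡 m) ∞ (fun z : G × M => z.1 • z.2))
    (hisom : ∀ (g : G) (x y : M), dist (g • x) (g • y) = dist x y)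
    (X : Set M) (hX : IsCompact X) :
    ∃ ε : ℝ, 0 < ε ∧ ∀ c : G ⧸ isotropySubgroup G X,
      ∃ 𝒦 : Set (Set (G ⧸ isotropySubgroup G X)),
        𝒦.Countable ∧ (∀ K ∈ 𝒦, IsCompact K) ∧ 𝒦.PairwiseDisjoint id ∧
          inducedHausdorffBall X c ε ⊆ ⋃₀ 𝒦 := by
  have : IsTopologicalGroup G := topologicalGroup_of_lieGroup (𝓡 n) ∞
  have : LocallyCompactSpace G := ChartedSpace.locallyCompactSpace (EuclideanSpace ℝ (Fin n)) G
  have : ContinuousSMul G M := ⟨hsmooth.continuous⟩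
  have : IsIsometricSMul G M := ⟨fun g => Isometry.of_dist_eq (hisom g)⟩
  rcases X.eq_empty_or_nonempty with rfl | hne
  -- For `X = ∅` the quotient is a single point, so any radius works.
  · have : Subsingleton (G ⧸ isotropySubgroup G (∅ : Set M)) :=
      ⟨fun p q => MulAction.injective_ofQuotientStabilizer G (∅ : Set M) <| by
        induction p using QuotientGroup.induction_on
        induction q using QuotientGroup.induction_on
        simp⟩
    exact ⟨1, one_pos, fun c => ⟨{Set.univ}, by simp [Set.subsingleton_of_subsingleton.isCompact]⟩⟩
  · exact exists_inducedHausdorffBall_subset_sUnion_isCompact hX hne
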